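/- Let $\mathcal M$ be the set of Lebesgue measurable subsets of $\mathbb R^d$, where two sets are identified when their symmetric difference is Lebesgue-null, with the topology of local convergence in measure ($A_n\to A$ iff $\mathcal L^d((A_n\Delta A)\cap U)\to 0$ for every bounded open $U$) and its Borel $\sigma$-algebra. A random measurable set (RAMS) is a measurable map $X$ from a probability space to $\mathcal M$. Let $G$ be a real vector space of bounded continuous functions $g:\mathcal M\to\mathbb R$ that contains the constants. Let $\chi:\mathcal M\to[0,\infty]$ be a $G$-regularity modulus, that is, $\chi$ is lower semi-continuous and for every $g\in G$ the level set $\{A\in\mathcal M:\chi(A)\le g(A)\}$ is relatively compact. Let $\Phi:G\to\mathbb R$ be linear with $\Phi(1)=1$. Let $\Theta$ be a commutative group of transformations of $\mathbb R^d$, i.e. of bijections $\theta$ of $\mathbb R^d$ such that $\theta$ and $\theta^{-1}$ map measurable sets to measurable sets and null sets to null sets. Assume that: 1. for all $\theta\in\Theta$ and $g\in G$, the function $\theta g:A\mapsto g(\theta A)$ belongs to $G$; 2. there is a sequence $(g_n)_{n\ge1}$ in $G$ with $0\le g_n\le\chi$ and $g_n(A)\to\chi(A)$ for every $A\in\mathcal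 M$; 3. $\chi$ is sub-invariant: for every $\theta\in\Theta$ there is a constant $C_\theta>0$ with $\chi(\theta A)\le C_\theta\,\chi(A)$ for all $A\in\mathcal M$; 4. $\Phi$ is $\Theta$-invariant: $\Phi(\theta g)=\Phi(g)$ for all $g\in G$, $\theta\in\Theta$. Then, for every real $r\ge0$, there exists a RAMS $X$ that is $\Theta$-invariant ($\theta X$ and $X$ have the same law for every $\theta\in\Theta$) and satisfies $$\mathbf E\,g(X)=\Phi(g)\quad\text{for all } g\in G,\qquad \mathbf E\,\chi(X)\le r,$$ if and only if $$\sup_{g\in G}\ \inf_{A\in\mathcal M}\ \bigl[\chi(A)-g(A)+\Phi(g)\bigr]\le r .$$ -/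

import Mathlib

open MeasureTheory ProbabilityTheory Filter Topology
open scoped ENNReal NNReal symmDiff

/-- Euclidean space of dimension `d`; `volume` is Lebesgue measure on it. -/
abbrev Euc (d : ℕ) : Type := EuclideanSpace ℝ (Fin d)

/-- Lebesgue measurable subsets of Euclidean space: `NullMeasurableSet` for `volume` means
measurable for the completion of the Borel sigma-algebra. -/
abbrev LebSet (d : ℕ) : Type := {A : Set (Euc d) // NullMeasurableSet A (volume : Measure (Euc d))}

/-- Equality of Lebesgue measurable sets up to a null set. -/
instance lebSetSetoid (d : ℕ) : Setoid (LebSet d) where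
  r A B := A.1 =ᵐ[volume] B.1
  iseqv := ⟨fun _ => ae_eq_rfl, fun h => h.symm, fun h h' => h.trans h'⟩

/-- The space `ℳ` of Lebesgue classes of measurable sets of Euclidean space. -/
def MeasClass (d : ℕ) : Type := Quotient (lebSetSetoid d)

/-- `locDist U A B` is the Lebesgue measure of `(A ∆ B) ∩ U`. -/
noncomputable def locDist {d : ℕ} (U : Set (Euc d)) (A B : MeasClass d) : ℝ≥0∞ :=
  Quotient.liftOn₂ A B (fun A B => volume ((A.1 ∆ B.1) ∩ U)) (by
    intro A B A' B' hA hB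
    have hA' : A.1 =ᵐ[volume] A'.1 := hA
    have hB' : B.1 =ᵐ[volume] B'.1 := hB
    exact measure_congr
      (((hA'.diff hB').union (hB'.diff hA')).inter (ae_eq_refl U)))

/-- The topology of local convergence in measure: it is generated by the balls
`{B | ℒ((A ∆ B) ∩ U) < ε}` of the pseudo-distances attached to the bounded open sets `U`. -/
instance measClassTopology (d : ℕ) : TopologicalSpace (MeasClass d) :=
  TopologicalSpace.generateFrom
    {S | ∃ (A : MeasClass d) (U : Set (Euc d)) (ε : ℝ≥0∞),
      IsOpen U ∧ Bornology.IsBounded U ∧ 0 < ε ∧ S = {B | locDist U A B < ε}}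

/-- The Borel sigma-algebra of the space of classes of measurable sets. -/
instance measClassMeasurableSpace (d : ℕ) : MeasurableSpace (MeasClass d) :=
  borel (MeasClass d)

instance measClassBorelSpace (d : ℕ) : BorelSpace (MeasClass d) := ⟨rfl⟩

/-- The transformations of Euclidean space that act on classes of measurable sets: the bijections
`θ` such that `θ` and its inverse map Lebesgue measurable sets to Lebesgue measurable sets and
null sets to null sets. They form a group under composition. -/
def LebTransf (d : ℕ) : Subgroup (Equiv.Perm (Euc d)) where
  carrier := {θ | ∀ A : Set (Euc d),
    (NullMeasurableSet (θ '' A) (volume : Measure (Euc d)) ↔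
      NullMeasurableSet A (volume : Measure (Euc d))) ∧
    (volume (θ '' A) = 0 ↔ volume A = 0)}
  one_mem' := by
    intro A
    simp
  mul_mem' := by
    intro a b ha hb A
    have h : (a * b : Equiv.Perm (Euc d)) '' A = a '' (b '' A) := by
      rw [Equiv.Perm.coe_mul, Set.image_comp]
    rw [h]
    exact ⟨(ha _).1.trans (hb _).1, (ha _).2.trans (hb _).2⟩
  inv_mem' := by
    intro a ha A
    have h : a '' ((a⁻¹ : Equiv.Perm (Euc d)) '' A) = A := by
      rw [← Set.image_comp, ← Equiv.Perm.coe_mul]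
      simp
    have h1 := ha ((a⁻¹ : Equiv.Perm (Euc d)) '' A)
    rw [h] at h1
    exact ⟨h1.1.symm, h1.2.symm⟩

/-- The image `θ A` of the class of a measurable set `A`. -/
def MeasClass.image {d : ℕ} (θ : LebTransf d) (A : MeasClass d) : MeasClass d :=
  Quotient.map' (s₁ := lebSetSetoid d) (s₂ := lebSetSetoid d)
    (fun A : LebSet d => (⟨θ.1 '' A.1, ((θ.2 A.1).1).2 A.2⟩ : LebSet d)) (by
      intro A B hAB
      have hAB' : A.1 =ᵐ[volume] B.1 := hAB
      show (θ.1 '' A.1 : Set (Euc d)) =ᵐ[volume] (θ.1 '' B.1 : Set (Euc d))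
      rw [← measure_symmDiff_eq_zero_iff] at hAB' ⊢
      rw [← Set.image_symmDiff θ.1.injective]
      exact ((θ.2 _).2).2 hAB') A

/-- The action on classes of measurable sets, `θ • A = θ A`. -/
instance lebTransfAction (d : ℕ) : MulAction (LebTransf d) (MeasClass d) where
  smul θ A := A.image θ
  one_smul A := by
    induction A using Quotient.inductionOn with
    | h A =>
      show MeasClass.image 1 _ = _
      exact congrArg (Quotient.mk (lebSetSetoid d)) (Subtype.ext (by simp))
  mul_smul a b A := by
    induction A using Quotient.inductionOn with
    | h A =>
      show MeasClass.image (a * b) _ = MeasClass.image a (MeasClass.image b _)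
      exact congrArg (Quotient.mk (lebSetSetoid d)) (Subtype.ext (by
        show ((a.1 * b.1 : Equiv.Perm (Euc d)) '' A.1) = a.1 '' (b.1 '' A.1)
        rw [Equiv.Perm.coe_mul, Set.image_comp]))

/-- A regularity modulus for a vector space `G` of functions: lower semi-continuous,
`[0, ∞]`-valued, and with relatively compact level sets `{χ ≤ g}`, `g ∈ G`. -/
structure IsRegularityModulus {d : ℕ} (G : Submodule ℝ (MeasClass d → ℝ))
    (χ : MeasClass d → ℝ≥0∞) : Prop where
  lowerSemicontinuous : LowerSemicontinuous χ
  isCompact_closure_levelSet : ∀ g ∈ G,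
    IsCompact (closure {A : MeasClass d | (χ A : EReal) ≤ (g A : EReal)})

/-- The condition `sup_{g ∈ G} inf_{A ∈ ℳ} (χ(A) - g(A) + Φ(g)) ≤ r`, in `[-∞, ∞]`. -/
def SupInfCondition {d : ℕ} (G : Submodule ℝ (MeasClass d → ℝ)) (χ : MeasClass d → ℝ≥0∞)
    (Φ : G →ₗ[ℝ] ℝ) (r : ℝ) : Prop :=
  ⨆ g : G, ⨅ A : MeasClass d,
    ((χ A : EReal) - ((g.1 A : ℝ) : EReal) + ((Φ g : ℝ) : EReal)) ≤ (r : EReal)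

/-- A random measurable set on the probability space `(Ω, P)`: a measurable map into `ℳ` with its
Borel sigma-algebra. -/
def IsRAMS {Ω : Type*} [MeasurableSpace Ω] {d : ℕ} (X : Ω → MeasClass d) : Prop :=
  Measurable X

/-- `X` is `Θ`-invariant: for all `θ ∈ Θ`, the random sets `θ X` and `X` have the same law. -/
def IsInvariantRAMS {Ω : Type*} [MeasurableSpace Ω] (P : Measure Ω) {d : ℕ}
    (Θ : Subgroup (LebTransf d)) (X : Ω → MeasClass d) : Prop :=
  IsRAMS X ∧ ∀ θ ∈ Θ, IdentDistrib (fun ω => θ • X ω) X P P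

/-! Necessity: integrate `χ - g + Φ g` against the law of `X`; the result is at most `r`, hence so
is the infimum.

Sufficiency is a duality argument followed by a fixed point argument. For finitely many `g ∈ G`, the
moments of probability measures together with a bound on `∫ χ` form a convex set. If the prescribed
values of `Φ` and `r` lay outside its closure, Hahn-Banach, tested on point masses, would give an
element of `G` violating the sup-inf condition (`mem_closure_momentSet`). Markov's inequality and
compact level sets of `χ` give tightness, so approximate solutions become exact and finite families
extend to all of `G` (`exists_represents`).

The condition also forces `Φ (g n) ≤ r` for the approximating sequence, so by Fatou every
representing measure satisfies `∫ χ ≤ r`. The representing measures therefore form a compact set,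
stable under averaging along `Θ` because `Φ` is invariant. Since `Θ` is commutative, a
Markov-Kakutani argument with Cesàro means yields an invariant one (`exists_represents_invariant`).
-/

/-- A finite measure which is absolutely continuous with respect to `μ` is uniformly so. -/
lemma MeasureTheory.Measure.AbsolutelyContinuous.exists_pos_forall_measure_lt {α : Type*}
    [MeasurableSpace α] {μ ν : Measure α} [SigmaFinite μ] [IsFiniteMeasure ν] (h : ν ≪ μ)
    {ε : ℝ≥0∞} (hε : ε ≠ 0) : ∃ δ > 0, ∀ s, μ s < δ → ν s < ε := by
  have hf : ∫⁻ x, ν.rnDeriv μ x ∂μ ≠ ∞ := (Measure.lintegral_rnDeriv_lt_top ν μ).ne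
  obtain ⟨δ, hδ, H⟩ := exists_pos_setLIntegral_lt_of_measure_lt hf hε
  refine ⟨δ, hδ, fun s hs => ?_⟩
  have := H s hs
  rwa [← withDensity_apply' , Measure.withDensity_rnDeriv_eq ν μ h] at this

/-! ### Metrisability of `ℳ` and continuity of the action -/

namespace MeasClass

variable {d : ℕ}

/-- The distance `μ (A ∆ B)` between classes of measurable sets. -/
noncomputable def dist' (μ : Measure (Euc d)) (hμ : μ ≪ volume) (A B : MeasClass d) : ℝ≥0∞ :=
  Quotient.liftOn₂ A B (fun A B => μ (A.1 ∆ B.1)) (by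
    intro A B A' B' hA hB
    have hA' : A.1 =ᵐ[μ] A'.1 := hμ.ae_eq hA
    have hB' : B.1 =ᵐ[μ] B'.1 := hμ.ae_eq hB
    exact measure_congr ((hA'.diff hB').union (hB'.diff hA')))

lemma locDist_triangle (U : Set (Euc d)) (A B C : MeasClass d) :
    locDist U A C ≤ locDist U A B + locDist U B C := by
  induction A using Quotient.inductionOn
  induction B using Quotient.inductionOn
  induction C using Quotient.inductionOn
  simp only [locDist, Quotient.liftOn₂_mk]
  refine (measure_mono ?_).trans (measure_union_le _ _)
  rw [← Set.union_inter_distrib_right]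
  exact Set.inter_subset_inter_left _ (symmDiff_triangle _ _ _)

/-- The metric `μ (A ∆ B)`, where `μ` is a finite measure equivalent to Lebesgue measure. -/
noncomputable abbrev finEMetric (d : ℕ) : EMetricSpace (MeasClass d) where
  edist := dist' (volume.toFinite) (toFinite_absolutelyContinuous _)
  edist_self A := by
    induction A using Quotient.inductionOn
    simp [dist']
  edist_comm A B := by
    induction A using Quotient.inductionOn
    induction B using Quotient.inductionOn
    simp only [dist', Quotient.liftOn₂_mk, symmDiff_comm]
  edist_triangle A B C := by
    induction A using Quotient.inductionOn
    induction B using Quotient.inductionOn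
    induction C using Quotient.inductionOn
    exact measure_symmDiff_le _ _ _
  eq_of_edist_eq_zero {A B} h := by
    induction A using Quotient.inductionOn with | h A =>
    induction B using Quotient.inductionOn with | h B =>
    apply Quotient.sound
    change A.1 =ᵐ[volume] B.1
    exact measure_symmDiff_eq_zero_iff.1 (absolutelyContinuous_toFinite _ h)

/-- A finite measure `ν ≪ volume` defines a distance that is uniformly small on classes that are
close for the metric `volume.toFinite (A ∆ B)`. -/
lemma exists_ball_of_le_measure {ν : Measure (Euc d)} [IsFiniteMeasure ν] (hν : ν ≪ volume)
    {ε : ℝ≥0∞} (hε : ε ≠ 0) : ∃ δ > 0, ∀ A B : MeasClass d,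
      dist' volume.toFinite (toFinite_absolutelyContinuous _) A B < δ → dist' ν hν A B < ε := by
  obtain ⟨δ, hδ, H⟩ := (hν.trans (absolutelyContinuous_toFinite _)).exists_pos_forall_measure_lt hε
  refine ⟨δ, hδ, fun A B h => ?_⟩
  induction A using Quotient.inductionOn
  induction B using Quotient.inductionOn
  exact H _ h

lemma locDist_eq_dist' {U : Set (Euc d)} (hU : IsOpen U) (A B : MeasClass d) :
    locDist U A B = dist' (volume.restrict U) Measure.restrict_le_self.absolutelyContinuous A B := by
  induction A using Quotient.inductionOn
  induction B using Quotient.inductionOn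
  simp only [locDist, dist', Quotient.liftOn₂_mk]
  rw [Measure.restrict_apply' hU.measurableSet]

lemma isOpen_locDist_ball (A : MeasClass d) {U : Set (Euc d)} (hU : IsOpen U)
    (hb : Bornology.IsBounded U) {ε : ℝ≥0∞} (hε : 0 < ε) : IsOpen {B | locDist U A B < ε} :=
  TopologicalSpace.isOpen_generateFrom_of_mem ⟨A, U, ε, hU, hb, hε, rfl⟩

/-- A large ball carries all but `ε / 2` of the finite measure, and inside it uniform absolute
continuity compares the two measures. Conversely, Lebesgue measure on a bounded set is finite and
absolutely continuous with respect to `volume.toFinite`. -/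
lemma measClassTopology_eq :
    measClassTopology d = (finEMetric d).toUniformSpace.toTopologicalSpace := by
  apply le_antisymm
  · intro s hs
    rw [@EMetric.isOpen_iff _ (finEMetric d).toPseudoEMetricSpace] at hs
    refine (@isOpen_iff_mem_nhds _ (measClassTopology d) s).2 fun A hA => ?_
    obtain ⟨ε, hε, hs⟩ := hs A hA
    set μ : Measure (Euc d) := volume.toFinite
    have hlim : Tendsto (fun n : ℕ => μ (Metric.ball 0 (n : ℝ))ᶜ) atTop (𝓝 0) := by
      have := tendsto_measure_iInter_atTop (μ := μ) (s := fun n : ℕ => (Metric.ball 0 (n : ℝ))ᶜ)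
        (fun n => Metric.isOpen_ball.measurableSet.compl.nullMeasurableSet)
        (fun m n h => Set.compl_subset_compl.2 (Metric.ball_subset_ball (by exact_mod_cast h)))
        ⟨0, measure_ne_top _ _⟩
      rwa [← Set.compl_iUnion, Metric.iUnion_ball_nat, Set.compl_univ, measure_empty] at this
    obtain ⟨n, hn⟩ := (hlim.eventually_lt_const (ENNReal.half_pos hε.ne')).exists
    set U : Set (Euc d) := Metric.ball 0 (n : ℝ)
    have hac : μ.restrict U ≪ volume.restrict U :=
      (toFinite_absolutelyContinuous (volume : Measure (Euc d))).restrict U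
    obtain ⟨δ, hδ, H⟩ := hac.exists_pos_forall_measure_lt (ENNReal.half_pos hε.ne').ne'
    have hmem : {B | locDist U A B < δ} ∈ @nhds _ (measClassTopology d) A := by
      apply (isOpen_locDist_ball A Metric.isOpen_ball Metric.isBounded_ball hδ).mem_nhds
      change locDist U A A < δ
      induction A using Quotient.inductionOn
      simpa [locDist] using hδ
    filter_upwards [hmem] with B hB
    refine hs ?_
    rw [@Metric.mem_eball' _ (finEMetric d).toPseudoEMetricSpace]
    change dist' μ _ A B < ε
    change locDist U A B < δ at hB
    induction A using Quotient.inductionOn with | h A =>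
    induction B using Quotient.inductionOn with | h B =>
    simp only [locDist, dist', Quotient.liftOn₂_mk] at hB ⊢
    rw [← Measure.restrict_apply' Metric.isOpen_ball.measurableSet] at hB
    have h1 := H _ hB
    rw [Measure.restrict_apply' Metric.isOpen_ball.measurableSet] at h1
    calc μ (A.1 ∆ B.1) ≤ μ ((A.1 ∆ B.1) ∩ U) + μ ((A.1 ∆ B.1) \ U) :=
          measure_le_inter_add_sdiff _ _ _
      _ < ε / 2 + ε / 2 := ENNReal.add_lt_add h1
          ((measure_mono (fun x hx => hx.2)).trans_lt hn)
      _ = ε := ENNReal.add_halves ε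
  · apply le_generateFrom
    rintro _ ⟨A, U, ε, hU, hb, hε, rfl⟩
    let := finEMetric d
    rw [EMetric.isOpen_iff]
    intro B hB
    have : IsFiniteMeasure (volume.restrict U) := ⟨by simpa using hb.measure_lt_top⟩
    obtain ⟨δ, hδ, H⟩ := exists_ball_of_le_measure (d := d)
      (Measure.restrict_le_self (μ := volume) (s := U)).absolutelyContinuous
      (tsub_pos_of_lt (show locDist U A B < ε from hB)).ne'
    refine ⟨δ, hδ, fun C hC => ?_⟩
    have h := H B C (by rw [Metric.mem_eball'] at hC; exact hC)
    rw [← locDist_eq_dist' hU] at h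
    exact (locDist_triangle U A B C).trans_lt (by
      rwa [lt_tsub_iff_left] at h)

instance metrizableSpace : TopologicalSpace.MetrizableSpace (MeasClass d) := by
  let : EMetricSpace (MeasClass d) := (finEMetric d).replaceTopology measClassTopology_eq
  exact EMetricSpace.metrizableSpace

/-- The pseudo-distance on `U`, pulled back by `θ`, is the one of the image `ν` of Lebesgue measure
on `U` under `θ⁻¹`. This `ν` is finite and absolutely continuous, which is all that is needed. -/
lemma continuous_smul (θ : LebTransf d) : Continuous (fun A : MeasClass d => θ • A) := by
  refine continuous_generateFrom_iff.2 ?_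
  rintro _ ⟨A, U, ε, hU, hb, hε, rfl⟩
  rw [measClassTopology_eq]
  let := finEMetric d
  rw [EMetric.isOpen_iff]
  intro B hB
  have hqmp : ∀ s, NullMeasurableSet s (volume : Measure (Euc d)) →
      NullMeasurableSet (⇑θ.1.symm ⁻¹' s) volume := fun s hs => by
    rw [← Equiv.image_eq_preimage_symm]
    exact ((θ.2 s).1).2 hs
  -- Preimages of Borel sets are only Lebesgue measurable, so `θ⁻¹` is merely a.e. equal to a Borel
  -- map.
  have hmeas : AEMeasurable (⇑θ.1.symm) (volume : Measure (Euc d)) :=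
    NullMeasurable.aemeasurable fun s hs => hqmp s hs.nullMeasurableSet
  have hmeas' : AEMeasurable (⇑θ.1.symm) (volume.restrict U) := hmeas.restrict
  have : IsFiniteMeasure (volume.restrict U) := ⟨by simpa using hb.measure_lt_top⟩
  set ν := (volume.restrict U).map (⇑θ.1.symm) with hν
  have : IsFiniteMeasure ν := inferInstance
  have hac : ν ≪ volume := by
    refine Measure.AbsolutelyContinuous.mk fun s hs h => ?_
    rw [hν, Measure.map_apply_of_aemeasurable hmeas' hs, ← Equiv.image_eq_preimage_symm]
    exact Measure.restrict_le_self.absolutelyContinuous (((θ.2 s).2).2 h)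
  have key : ∀ B C : MeasClass d, locDist U (θ • B) (θ • C) = dist' ν hac B C := by
    intro B C
    induction B using Quotient.inductionOn with | h B =>
    induction C using Quotient.inductionOn with | h C =>
    change volume (((θ.1 '' B.1) ∆ (θ.1 '' C.1)) ∩ U) = ν (B.1 ∆ C.1)
    have hn : NullMeasurableSet (B.1 ∆ C.1) volume := B.2.symmDiff C.2
    rw [hν, Measure.map_apply₀ hmeas' (hn.mono_ac hac), Measure.restrict_apply' hU.measurableSet,
      ← Equiv.image_eq_preimage_symm, Set.image_symmDiff θ.1.injective]
  obtain ⟨δ, hδ, H⟩ := exists_ball_of_le_measure hac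
      (tsub_pos_of_lt (show locDist U A (θ • B) < ε from hB)).ne'
  refine ⟨δ, hδ, fun C hC => ?_⟩
  have h := H B C (by rw [Metric.mem_eball'] at hC; exact hC)
  rw [← key] at h
  exact (locDist_triangle U A (θ • B) (θ • C)).trans_lt (by rwa [lt_tsub_iff_left] at h)

end MeasClass

lemma isProbabilityMeasure_mix {E : Type*} [MeasurableSpace E] {P Q : Measure E} [IsProbabilityMeasure P] [IsProbabilityMeasure Q]
    {a b : ℝ} (ha : 0 ≤ a) (hb : 0 ≤ b) (hab : a + b = 1) :
    IsProbabilityMeasure (ENNReal.ofReal a • P + ENNReal.ofReal b • Q) :=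
  ⟨by simp [← ENNReal.ofReal_add ha hb, hab]⟩

/-! ### Cesàro means and invariant measures -/

section BoundedContinuous

variable {E : Type*} [TopologicalSpace E] [MeasurableSpace E] [BorelSpace E]

lemma integrable_of_continuous_of_bounded {f : E → ℝ} (hf : Continuous f)
    (hb : ∃ C : ℝ, ∀ x, |f x| ≤ C) (P : Measure E) [IsFiniteMeasure P] : Integrable f P := by
  obtain ⟨C, hC⟩ := hb
  exact Integrable.of_bound hf.measurable.aestronglyMeasurable C (ae_of_all _ hC)

lemma continuous_integral_of_bounded {f : E → ℝ} (hf : Continuous f)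
    (hb : ∃ C : ℝ, ∀ x, |f x| ≤ C) :
    Continuous fun P : ProbabilityMeasure E => ∫ x, f x ∂(P : Measure E) := by
  obtain ⟨C, hC⟩ := hb
  exact ProbabilityMeasure.continuous_integral_boundedContinuousFunction
    (BoundedContinuousFunction.ofNormedAddCommGroup f hf C hC)

/-- The mean of the images of a measure under the first `n + 1` iterates of a map. -/
noncomputable def cesaroMeasure (f : E → E) (P : Measure E) (n : ℕ) : Measure E :=
  ENNReal.ofReal ((n + 1 : ℝ)⁻¹) • ∑ i ∈ Finset.range (n + 1), P.map f^[i]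

lemma integral_cesaroMeasure {f : E → E} (hf : Continuous f) (P : Measure E)
    [IsProbabilityMeasure P] (n : ℕ) {g : E → ℝ} (hg : Continuous g)
    (hb : ∃ C : ℝ, ∀ x, |g x| ≤ C) :
    ∫ x, g x ∂(cesaroMeasure f P n) =
      (n + 1 : ℝ)⁻¹ * ∑ i ∈ Finset.range (n + 1), ∫ x, g (f^[i] x) ∂P := by
  have hpos : (0 : ℝ) ≤ (n + 1 : ℝ)⁻¹ := by positivity
  rw [cesaroMeasure, integral_smul_measure, ENNReal.toReal_ofReal hpos,
    integral_finsetSum_measure fun i _ => integrable_of_continuous_of_bounded hg hb _, smul_eq_mul]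
  congr 1
  refine Finset.sum_congr rfl fun i _ => ?_
  exact integral_map (hf.iterate i).measurable.aemeasurable hg.measurable.aestronglyMeasurable

lemma isProbabilityMeasure_cesaroMeasure {f : E → E} (hf : Continuous f) (P : Measure E)
    [IsProbabilityMeasure P] (n : ℕ) : IsProbabilityMeasure (cesaroMeasure f P n) := by
  have h : ∀ i, P.map f^[i] Set.univ = 1 := fun i => by
    rw [Measure.map_apply (hf.iterate i).measurable MeasurableSet.univ]; simp
  refine ⟨?_⟩
  have hn : (0 : ℝ) < n + 1 := by positivity
  simp only [cesaroMeasure, Measure.smul_apply, Measure.coe_finsetSum, Finset.sum_apply, h,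
    Finset.sum_const, Finset.card_range, smul_eq_mul, nsmul_eq_mul, mul_one]
  rw [← ENNReal.ofReal_natCast, ← ENNReal.ofReal_mul (by positivity)]
  push_cast
  rw [inv_mul_cancel₀ hn.ne', ENNReal.ofReal_one]

lemma map_cesaroMeasure_of_commute {f h : E → E} (hf : Continuous f) (hh : Continuous h)
    (hfh : Function.Commute h f) {P : Measure E} (hP : P.map h = P) (n : ℕ) :
    (cesaroMeasure f P n).map h = cesaroMeasure f P n := by
  rw [cesaroMeasure, Measure.map_smul, Measure.map_finset_sum hh.measurable.aemeasurable]
  congr 1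
  refine Finset.sum_congr rfl fun i _ => ?_
  rw [Measure.map_map hh.measurable (hf.iterate i).measurable,
    show h ∘ f^[i] = f^[i] ∘ h from funext fun x => hfh.iterate_right i x,
    ← Measure.map_map (hf.iterate i).measurable hh.measurable, hP]

/-- Krylov-Bogoliubov: a compact set of probability measures that contains the Cesàro means of
some measure under a continuous map contains an invariant measure. -/
lemma exists_map_eq_of_cesaroMeasure_mem [TopologicalSpace.MetrizableSpace E]
    {K : Set (ProbabilityMeasure E)} (hK : IsCompact K) {f : E → E} (hf : Continuous f)
    (P : Measure E) [IsProbabilityMeasure P]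
    (hPK : ∀ n, (⟨cesaroMeasure f P n, isProbabilityMeasure_cesaroMeasure hf P n⟩ :
      ProbabilityMeasure E) ∈ K) :
    ∃ Q ∈ K, (Q : Measure E).map f = Q := by
  let := TopologicalSpace.metrizableSpaceMetric E
  set q : ℕ → ProbabilityMeasure E :=
    fun n => ⟨cesaroMeasure f P n, isProbabilityMeasure_cesaroMeasure hf P n⟩
  set U : Ultrafilter ℕ := Ultrafilter.of atTop
  obtain ⟨Q, hQK, hQ⟩ := hK.ultrafilter_le_nhds (U.map q)
    (le_principal_iff.2 (Ultrafilter.mem_map.2 (univ_mem' hPK)))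
  have hq : Tendsto q U (𝓝 Q) := hQ
  refine ⟨Q, hQK, ?_⟩
  have : IsProbabilityMeasure ((Q : Measure E).map f) :=
    Measure.isProbabilityMeasure_map hf.measurable.aemeasurable
  refine ext_of_forall_integral_eq_of_IsFiniteMeasure fun g => ?_
  have hgb : ∃ C : ℝ, ∀ x, |g x| ≤ C := ⟨‖g‖, g.norm_coe_le_norm⟩
  have hgfb : ∃ C : ℝ, ∀ x, |g (f x)| ≤ C := ⟨‖g‖, fun x => g.norm_coe_le_norm _⟩
  rw [integral_map hf.measurable.aemeasurable g.continuous.measurable.aestronglyMeasurable]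
  have h1 := ((continuous_integral_of_bounded (g.continuous.comp hf) hgfb).tendsto Q).comp hq
  have h2 := ((continuous_integral_of_bounded g.continuous hgb).tendsto Q).comp hq
  have h3 : Tendsto (fun n => ∫ x, g (f x) ∂(cesaroMeasure f P n) -
      ∫ x, g x ∂(cesaroMeasure f P n)) atTop (𝓝 0) := by
    have hlim : Tendsto (fun n : ℕ => (2 * ‖g‖) * (1 / ((n : ℝ) + 1))) atTop (𝓝 0) := by
      simpa using tendsto_one_div_add_atTop_nhds_zero_nat.const_mul (2 * ‖g‖)
    refine squeeze_zero_norm (fun n => ?_) hlim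
    rw [integral_cesaroMeasure hf P n (g := fun x => g (f x)) (g.continuous.comp hf) hgfb,
      integral_cesaroMeasure hf P n g.continuous hgb, ← mul_sub, ← Finset.sum_sub_distrib]
    -- The sum telescopes: only the terms of index `n + 1` and `0` remain, each at most `‖g‖`.
    simp only [← Function.iterate_succ_apply']
    rw [Finset.sum_range_sub (fun i => ∫ x, g (f^[i] x) ∂P)]
    have hle : ∀ i, ‖∫ x, g (f^[i] x) ∂P‖ ≤ ‖g‖ := fun i => by
      simpa using norm_integral_le_of_norm_le_const (μ := P) (C := ‖g‖)
        (ae_of_all _ fun x => g.norm_coe_le_norm (f^[i] x))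
    have h4 := (norm_sub_le (∫ x, g (f^[n + 1] x) ∂P) (∫ x, g (f^[0] x) ∂P)).trans
      (add_le_add (hle _) (hle _))
    rw [norm_mul, norm_inv, Real.norm_of_nonneg (by positivity : (0 : ℝ) ≤ (n : ℝ) + 1), one_div,
      mul_comm]
    exact mul_le_mul_of_nonneg_right (by linarith) (by positivity)
  have h5 := tendsto_nhds_unique (h1.sub h2) (h3.mono_left (Ultrafilter.of_le _))
  exact sub_eq_zero.1 h5

end BoundedContinuous

/-! ### Tightness and realisability of `Φ` -/

/-- The probability measures with the tail bounds given by `∫ χ ≤ R`. -/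
def tailSet {E : Type*} [MeasurableSpace E] (χ : E → ℝ≥0∞) (R : ℝ) : Set (ProbabilityMeasure E) :=
  {P | ∀ n : ℕ, P {x | χ x ≤ (n + 1 : ℕ)}ᶜ ≤ R.toNNReal / (n + 1)}

/-- Markov's inequality at level `n + 1`; the shift avoids dividing by zero. -/
lemma mem_tailSet {E : Type*} [MeasurableSpace E] {χ : E → ℝ≥0∞} (hχ : Measurable χ) {R : ℝ} {P : ProbabilityMeasure E}
    (hP : ∫⁻ x, χ x ∂(P : Measure E) ≤ ENNReal.ofReal R) : P ∈ tailSet χ R := by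
  intro n
  rw [← ENNReal.coe_le_coe, ProbabilityMeasure.ennreal_coeFn_eq_coeFn_toMeasure,
    ENNReal.coe_div (by positivity)]
  calc (P : Measure E) {x | χ x ≤ (n + 1 : ℕ)}ᶜ
      ≤ (P : Measure E) {x | ((n + 1 : ℕ) : ℝ≥0∞) ≤ χ x} :=
        measure_mono fun x hx => (not_le.1 (show ¬ χ x ≤ (n + 1 : ℕ) from hx)).le
    _ ≤ (∫⁻ x, χ x ∂(P : Measure E)) / ((n + 1 : ℕ) : ℝ≥0∞) :=
        meas_ge_le_lintegral_div hχ.aemeasurable (by simp) (by simp)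
    _ ≤ _ := by
        push_cast
        gcongr
        exact hP

section Realisability

variable {E : Type*} [TopologicalSpace E] [MeasurableSpace E] [BorelSpace E]

/-- The measure `P` integrates the functions of `G` to the values of `Φ`. -/
def Represents {G : Submodule ℝ (E → ℝ)} (Φ : G →ₗ[ℝ] ℝ) (P : Measure E) : Prop :=
  ∀ g : G, ∫ x, g.1 x ∂P = Φ g

/-- The finite-dimensional moments of the probability measures with `∫ χ ≤ t`. -/
def momentSet {ι : Type*} (g : ι → E → ℝ) (χ : E → ℝ≥0∞) : Set ((ι → ℝ) × ℝ) :=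
  {p | ∃ P : Measure E, IsProbabilityMeasure P ∧ (∀ i, ∫ x, g i x ∂P = p.1 i) ∧ 0 ≤ p.2 ∧
    ∫⁻ x, χ x ∂P ≤ ENNReal.ofReal p.2}

lemma convex_momentSet {ι : Type*} {g : ι → E → ℝ} (hg : ∀ i, Continuous (g i))
    (hb : ∀ i, ∃ C : ℝ, ∀ x, |g i x| ≤ C) (χ : E → ℝ≥0∞) : Convex ℝ (momentSet g χ) := by
  rintro p ⟨P, hP, hP1, hP2, hP3⟩ q ⟨Q, hQ, hQ1, hQ2, hQ3⟩ a b ha hb' hab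
  refine ⟨_, isProbabilityMeasure_mix (P := P) (Q := Q) ha hb' hab, fun i => ?_, ?_, ?_⟩
  · have h1 := (integrable_of_continuous_of_bounded (hg i) (hb i) P).smul_measure
      (ENNReal.ofReal_ne_top (r := a))
    have h2 := (integrable_of_continuous_of_bounded (hg i) (hb i) Q).smul_measure
      (ENNReal.ofReal_ne_top (r := b))
    rw [integral_add_measure h1 h2]
    simp [integral_smul_measure, ha, hb', hP1, hQ1]
  · simp only [Prod.snd_add, Prod.smul_snd, smul_eq_mul]
    positivity
  · rw [lintegral_add_measure, lintegral_smul_measure, lintegral_smul_measure]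
    simp only [Prod.snd_add, Prod.smul_snd, smul_eq_mul]
    rw [ENNReal.ofReal_add (by positivity) (by positivity), ENNReal.ofReal_mul ha,
      ENNReal.ofReal_mul hb']
    gcongr

variable {G : Submodule ℝ (E → ℝ)} {Φ : G →ₗ[ℝ] ℝ} {χ : E → ℝ≥0∞} {r : ℝ}

lemma isClosed_setOf_represents (hG : ∀ g ∈ G, Continuous g)
    (hGb : ∀ g ∈ G, ∃ C : ℝ, ∀ x, |g x| ≤ C) :
    IsClosed {P : ProbabilityMeasure E | Represents Φ (P : Measure E)} := by
  simp only [Represents, Set.ofPred_forall]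
  exact isClosed_iInter fun g =>
    isClosed_eq (continuous_integral_of_bounded (hG _ g.2) (hGb _ g.2)) continuous_const

/-- Fatou's lemma along an approximation of `χ` from `G`. -/
lemma Represents.lintegral_le (hG : ∀ g ∈ G, Continuous g)
    (hGb : ∀ g ∈ G, ∃ C : ℝ, ∀ x, |g x| ≤ C) {g : ℕ → G} (hg0 : ∀ n x, 0 ≤ (g n).1 x)
    (hlim : ∀ x, Tendsto (fun n => ENNReal.ofReal ((g n).1 x)) atTop (𝓝 (χ x)))
    (hΦ : ∀ n, Φ (g n) ≤ r) {P : Measure E} [IsProbabilityMeasure P] (hP : Represents Φ P) :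
    ∫⁻ x, χ x ∂P ≤ ENNReal.ofReal r := by
  have h1 : ∀ n, ∫⁻ x, ENNReal.ofReal ((g n).1 x) ∂P ≤ ENNReal.ofReal r := fun n => by
    rw [← ofReal_integral_eq_lintegral_ofReal
      (integrable_of_continuous_of_bounded (hG _ (g n).2) (hGb _ (g n).2) P)
      (ae_of_all _ (hg0 n)), hP]
    exact ENNReal.ofReal_le_ofReal (hΦ n)
  calc ∫⁻ x, χ x ∂P = ∫⁻ x, liminf (fun n => ENNReal.ofReal ((g n).1 x)) atTop ∂P := by
        simp only [(hlim _).liminf_eq]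
    _ ≤ liminf (fun n => ∫⁻ x, ENNReal.ofReal ((g n).1 x) ∂P) atTop :=
        lintegral_liminf_le fun n => (hG _ (g n).2).measurable.ennreal_ofReal
    _ ≤ liminf (fun _ : ℕ => ENNReal.ofReal r) atTop :=
        liminf_le_liminf (Eventually.of_forall h1)
    _ = ENNReal.ofReal r := liminf_const _

variable [TopologicalSpace.MetrizableSpace E]

lemma mem_momentSet_of_le {ι : Type*} (g : ι → E → ℝ) {χ : E → ℝ≥0∞} {x : E} {t : ℝ}
    (ht : 0 ≤ t) (hx : χ x ≤ ENNReal.ofReal t) : ((fun i => g i x), t) ∈ momentSet g χ :=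
  ⟨Measure.dirac x, inferInstance, fun i => by simp, ht, by simpa using hx⟩

/-- If `inf (χ - g + Φ g) ≤ r` for all `g`, then the prescribed moments are limits of moments of
probability measures with `∫ χ ≤ r + o(1)`. -/
lemma mem_closure_momentSet (hG : ∀ g ∈ G, Continuous g)
    (hGb : ∀ g ∈ G, ∃ C : ℝ, ∀ x, |g x| ≤ C) (hr : 0 ≤ r)
    (hinf : ∀ (g : G) (m : ℝ), (∀ x, χ x ≠ ∞ → m ≤ (χ x).toReal - g.1 x + Φ g) → m ≤ r)
    (s : Finset G) :
    ((fun g : s => Φ g), r) ∈ closure (momentSet (fun g : s => g.1.1) χ) := by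
  classical
  by_contra hn
  obtain ⟨f, u, hu, hu'⟩ := geometric_hahn_banach_closed_point
    (convex_momentSet (fun g : s => hG _ g.1.2) (fun g : s => hGb _ g.1.2) χ).closure
    isClosed_closure hn
  set a : s → ℝ := fun g => f (Pi.single g 1, 0) with ha
  set b : ℝ := f (0, 1) with hb
  have hf : ∀ c t, f (c, t) = ∑ g, c g * a g + t * b := by
    intro c t
    have h1 : (c, t) = (∑ g, c g • ((Pi.single g 1 : s → ℝ), (0 : ℝ))) + t • ((0 : s → ℝ), (1 : ℝ)) := by
      refine Prod.ext ?_ ?_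
      · ext i
        simp [Prod.fst_sum, Finset.sum_apply, Pi.single_apply]
      · simp [Prod.snd_sum]
    rw [h1, map_add, map_sum, map_smul]
    simp only [map_smul, smul_eq_mul, ha, hb]
  set h : G := ∑ g : s, a g • g.1 with hh
  have hhx : ∀ x, h.1 x = ∑ g : s, g.1.1 x * a g := fun x => by
    simp [hh, mul_comm]
  have hΦh : Φ h = ∑ g : s, Φ g * a g := by
    simp [hh, mul_comm]
  have hle : ∀ x t, 0 ≤ t → χ x ≤ ENNReal.ofReal t → h.1 x + t * b < u := by
    intro x t ht hx
    rw [hhx, ← hf]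
    exact hu _ (subset_closure (mem_momentSet_of_le _ ht hx))
  rw [hf, ← hΦh] at hu'
  by_cases hne : ∃ x, χ x ≠ ∞
  · obtain ⟨x₀, hx₀⟩ := hne
    -- The bound `t` on `∫ χ` may be increased freely, so a positive coefficient `b` would make the
    -- functional unbounded above on the moment set.
    have hb0 : b ≤ 0 := by
      by_contra! hb0
      have hx0 := hle x₀ ((χ x₀).toReal + |(u - h.1 x₀) / b|) (by positivity)
        ((ENNReal.le_ofReal_iff_toReal_le hx₀ (by positivity)).2 (by
          linarith [abs_nonneg ((u - h.1 x₀) / b)]))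
      have h2 : (u - h.1 x₀) / b ≤ (χ x₀).toReal + |(u - h.1 x₀) / b| :=
        (le_abs_self _).trans (by linarith [ENNReal.toReal_nonneg (a := χ x₀)])
      rw [div_le_iff₀ hb0] at h2
      linarith
    -- One would divide `h` by `-b`, but `b` may vanish. Adding a small multiple of the separation
    -- gap `e` makes the divisor `k` positive, at a cost `r * e / (2 * (r + 1)) < e` that the gap
    -- absorbs.
    set e := Φ h + r * b - u with he
    have he0 : 0 < e := by linarith
    set k := -b + e / (2 * (r + 1)) with hk
    have hq : 0 < e / (2 * (r + 1)) := by positivity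
    have hk0 : 0 < k := by linarith
    have hrq : r * (e / (2 * (r + 1))) < e := by
      rw [mul_div_assoc', div_lt_iff₀ (by positivity)]
      nlinarith
    have := hinf (k⁻¹ • h) (k⁻¹ * (Φ h - u)) (fun x hx => by
      have h3 := hle x (χ x).toReal ENNReal.toReal_nonneg (ENNReal.ofReal_toReal hx).ge
      have h4 : k * (χ x).toReal - h.1 x ≥ -u := by
        have : 0 ≤ e / (2 * (r + 1)) * (χ x).toReal := by positivity
        rw [hk]
        linarith
      have h5 : (χ x).toReal - (k⁻¹ • h : G).1 x + Φ (k⁻¹ • h)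
          = k⁻¹ * (k * (χ x).toReal - h.1 x + Φ h) := by
        rw [map_smul]
        simp only [Submodule.coe_smul, Pi.smul_apply, smul_eq_mul]
        field_simp
      rw [h5]
      exact mul_le_mul_of_nonneg_left (by linarith) (by positivity))
    rw [inv_mul_le_iff₀ hk0] at this
    rw [hk] at this
    linarith
  · push Not at hne
    -- With `χ` infinite everywhere, any real is vacuously a lower bound.
    have := hinf 0 (r + 1) (fun x hx => (hx (hne x)).elim)
    linarith

/-- Prokhorov's theorem: the mass outside the compact level sets is uniformly small, and bounds on
the mass of open sets survive weak limits. -/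
lemma isCompact_tailSet (hK : ∀ n : ℕ, IsCompact {x | χ x ≤ n}) (R : ℝ) :
    IsCompact (tailSet χ R) := by
  let := TopologicalSpace.metrizableSpaceMetric E
  refine isCompact_setOfPred_probabilityMeasure_mass_eq_compl_isCompact_le
    (u := fun n : ℕ => R.toNNReal / (n + 1)) ?_ (fun n => hK _) (Or.inl inferInstance)
  have := (tendsto_one_div_add_atTop_nhds_zero_nat (𝕜 := ℝ≥0)).const_mul R.toNNReal
  simpa [div_eq_mul_inv] using this

/-- For finitely many `g`, the moment image of the compact tail set is closed, so approximate
moments are attained; the finite intersection property handles all of `G`. -/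
lemma exists_represents (hG : ∀ g ∈ G, Continuous g)
    (hGb : ∀ g ∈ G, ∃ C : ℝ, ∀ x, |g x| ≤ C) (hχ : Measurable χ)
    (hK : ∀ n : ℕ, IsCompact {x | χ x ≤ n}) (hr : 0 ≤ r)
    (hinf : ∀ (g : G) (m : ℝ), (∀ x, χ x ≠ ∞ → m ≤ (χ x).toReal - g.1 x + Φ g) → m ≤ r) :
    ∃ P : ProbabilityMeasure E, Represents Φ (P : Measure E) := by
  -- Approximants only satisfy `∫ χ ≤ r + o(1)`; the extra `1` puts them all in one compact set.
  have hT := isCompact_tailSet hK (r + 1)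
  obtain ⟨P, -, hP⟩ := hT.inter_iInter_nonempty
    (fun g : G => {P : ProbabilityMeasure E | ∫ x, g.1 x ∂(P : Measure E) = Φ g})
    (fun g => isClosed_eq (continuous_integral_of_bounded (hG _ g.2) (hGb _ g.2)) continuous_const)
    (fun s => by
      set F : ProbabilityMeasure E → (s → ℝ) := fun P g => ∫ x, g.1.1 x ∂(P : Measure E) with hF
      have hFc : Continuous F := continuous_pi fun g =>
        continuous_integral_of_bounded (hG _ g.1.2) (hGb _ g.1.2)
      have hmem : (fun g : s => Φ g) ∈ closure (F '' tailSet χ (r + 1)) := by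
        rw [Metric.mem_closure_iff]
        intro ε hε
        obtain ⟨p, ⟨P, hP, hP1, -, hP3⟩, hp⟩ := Metric.mem_closure_iff.1
          (mem_closure_momentSet hG hGb hr hinf s) (min ε 1) (by positivity)
        rw [Prod.dist_eq, max_lt_iff, Real.dist_eq] at hp
        refine ⟨p.1, ⟨⟨P, hP⟩, mem_tailSet hχ (hP3.trans (ENNReal.ofReal_le_ofReal ?_)), ?_⟩,
          hp.1.trans_le (min_le_left _ _)⟩
        · have := (abs_lt.1 (hp.2.trans_le (min_le_right _ _))).1
          linarith
        · exact funext hP1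
      rw [(hT.image hFc).isClosed.closure_eq] at hmem
      obtain ⟨P, hPT, hP⟩ := hmem
      exact ⟨P, hPT, Set.mem_iInter₂.2 fun g hg => congrFun hP ⟨g, hg⟩⟩)
  exact ⟨P, fun g => Set.mem_iInter.1 hP g⟩

/-- A compact set of representing measures contains one that is invariant under a commuting family
of continuous maps which preserve `Φ`. -/
lemma exists_represents_invariant (hG : ∀ g ∈ G, Continuous g)
    (hGb : ∀ g ∈ G, ∃ C : ℝ, ∀ x, |g x| ≤ C)
    (hK : IsCompact {P : ProbabilityMeasure E | Represents Φ (P : Measure E)})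
    (hne : ∃ P : ProbabilityMeasure E, Represents Φ (P : Measure E))
    {ι : Type*} {T : ι → E → E} (hT : ∀ i, Continuous (T i))
    (hcomm : ∀ i j, Function.Commute (T i) (T j))
    (hstable : ∀ i, ∀ g ∈ G, (fun x => g (T i x)) ∈ G)
    (hinv : ∀ i (g : G), Φ ⟨fun x => g.1 (T i x), hstable i _ g.2⟩ = Φ g) :
    ∃ P : ProbabilityMeasure E, Represents Φ (P : Measure E) ∧
      ∀ i, (P : Measure E).map (T i) = P := by
  classical
  let := TopologicalSpace.metrizableSpaceMetric E
  have hclosed : ∀ i, IsClosed {P : ProbabilityMeasure E | (P : Measure E).map (T i) = P} := by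
    intro i
    have h := isClosed_eq (ProbabilityMeasure.continuous_map (hT i)) continuous_id
    convert h using 2
    ext P
    exact (Subtype.ext_iff (a1 := P.map (hT i).measurable.aemeasurable) (a2 := P)).symm
  have hit : ∀ i (n : ℕ) (g : G), ∃ h : (fun x => g.1 ((T i)^[n] x)) ∈ G, Φ ⟨_, h⟩ = Φ g := by
    intro i n g
    induction n with
    | zero => exact ⟨g.2, rfl⟩
    | succ n ih =>
      obtain ⟨h1, h2⟩ := ih
      exact ⟨hstable i _ h1, (hinv i ⟨_, h1⟩).trans h2⟩
  -- Averaging along a new map `T j` preserves invariance under the earlier maps, since they commute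
  -- with `T j`.
  have hfin : ∀ s : Finset ι, ∃ P : ProbabilityMeasure E, Represents Φ (P : Measure E) ∧
      ∀ i ∈ s, (P : Measure E).map (T i) = P := by
    intro s
    induction s using Finset.induction_on with
    | empty =>
      obtain ⟨P, hP⟩ := hne
      exact ⟨P, hP, by simp⟩
    | insert j s _ ih =>
      obtain ⟨P, hP, hPs⟩ := ih
      have hK' := hK.inter_right
        (isClosed_iInter fun i => isClosed_iInter fun _ : i ∈ s => hclosed i)
      obtain ⟨Q, ⟨hQ1, hQ2⟩, hQ⟩ := exists_map_eq_of_cesaroMeasure_mem hK' (hT j) (P : Measure E)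
        (fun n => ⟨fun g => by
          have hn : (n + 1 : ℝ) ≠ 0 := by positivity
          change ∫ x, g.1 x ∂(cesaroMeasure (T j) P n) = _
          rw [integral_cesaroMeasure (hT j) _ n (hG _ g.2) (hGb _ g.2),
            Finset.sum_congr rfl fun i _ => (hP ⟨_, (hit j i g).1⟩).trans (hit j i g).2]
          simp [hn],
          Set.mem_iInter₂.2 fun i hi =>
            map_cesaroMeasure_of_commute (hT j) (hT i) (hcomm i j) (hPs i hi) n⟩)
      refine ⟨Q, hQ1, fun i hi => ?_⟩
      rcases Finset.mem_insert.1 hi with rfl | hi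
      · exact hQ
      · exact Set.mem_iInter₂.1 hQ2 i hi
  obtain ⟨P, hP1, hP2⟩ := hK.inter_iInter_nonempty _ hclosed fun s => by
    obtain ⟨P, hP, hPs⟩ := hfin s
    exact ⟨P, hP, Set.mem_iInter₂.2 hPs⟩
  exact ⟨P, hP1, fun i => Set.mem_iInter.1 hP2 i⟩

end Realisability

/-! ### Regularity moduli and the sup-inf condition -/

section RegularityModulus

variable {d : ℕ} {G : Submodule ℝ (MeasClass d → ℝ)} {χ : MeasClass d → ℝ≥0∞} {Φ : G →ₗ[ℝ] ℝ}
  {r : ℝ}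

/-- Constants lie in `G`, and lower semi-continuity makes the level sets closed. -/
lemma IsRegularityModulus.isCompact_setOf_le (hχ : IsRegularityModulus G χ)
    (hG : ∀ c : ℝ, (fun _ : MeasClass d => c) ∈ G) (n : ℕ) : IsCompact {A | χ A ≤ n} := by
  refine (hχ.isCompact_closure_levelSet _ (hG n)).of_isClosed_subset
    (hχ.lowerSemicontinuous.isClosed_preimage n) (subset_trans (fun A hA => ?_) subset_closure)
  exact EReal.coe_ennreal_le_coe_ennreal_iff.2 hA

/-- Points where `χ = ∞` contribute `⊤`, so they never lower the infimum. -/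
lemma SupInfCondition.apply_le (h : SupInfCondition G χ Φ r) {g : G} {m : ℝ}
    (hm : ∀ A, χ A ≠ ∞ → m ≤ (χ A).toReal - g.1 A + Φ g) : m ≤ r := by
  rw [← EReal.coe_le_coe_iff]
  refine le_trans (le_iInf fun A => ?_) ((le_iSup _ g).trans h)
  by_cases hA : χ A = ∞
  · simp [hA]
  · have h1 := hm A hA
    rw [← ENNReal.ofReal_toReal hA, EReal.coe_ennreal_ofReal, max_eq_left ENNReal.toReal_nonneg]
    exact_mod_cast h1

/-- Integrating `χ - g + Φ g` against a representing random element. -/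
lemma supInfCondition_of_represents (hG : ∀ g ∈ G, Continuous g)
    (hGb : ∀ g ∈ G, ∃ C : ℝ, ∀ A, |g A| ≤ C) {Ω : Type*} [MeasurableSpace Ω] {P : Measure Ω}
    [IsProbabilityMeasure P] {X : Ω → MeasClass d} (hX : Measurable X)
    (hΦ : ∀ g : G, ∫ ω, g.1 (X ω) ∂P = Φ g) (hr : 0 ≤ r)
    (hχ : ∫⁻ ω, χ (X ω) ∂P ≤ ENNReal.ofReal r) : SupInfCondition G χ Φ r := by
  refine iSup_le fun g => ?_
  by_contra! hlt
  obtain ⟨m, hrm, hm⟩ := EReal.lt_iff_exists_real_btwn.1 hlt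
  rw [EReal.coe_lt_coe_iff] at hrm
  -- Passing to the positive part turns the bound into one in `[0, ∞]`; the integral `m` of the
  -- signed function is at most that of its positive part, hence at most `r`.
  have hle : ∀ A, ENNReal.ofReal (m + g.1 A - Φ g) ≤ χ A := by
    intro A
    by_cases hA : χ A = ∞
    · simp [hA]
    · have h1 := (hm.trans_le (iInf_le _ A)).le
      rw [← ENNReal.ofReal_toReal hA, EReal.coe_ennreal_ofReal,
        max_eq_left ENNReal.toReal_nonneg] at h1
      have h2 : m ≤ (χ A).toReal - g.1 A + Φ g := by exact_mod_cast h1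
      rw [ENNReal.ofReal_le_iff_le_toReal hA]
      linarith
  have hint : Integrable (fun ω => g.1 (X ω)) P := by
    obtain ⟨C, hC⟩ := hGb _ g.2
    exact Integrable.of_bound ((hG _ g.2).measurable.comp hX).aestronglyMeasurable C
      (ae_of_all _ fun ω => hC _)
  have hint' : Integrable (fun ω => m + g.1 (X ω) - Φ g) P :=
    ((integrable_const m).add hint).sub (integrable_const _)
  have h3 : ∫ ω, (m + g.1 (X ω) - Φ g) ∂P = m := by
    rw [integral_sub (f := fun ω => m + g.1 (X ω)) ((integrable_const m).add hint) (integrable_const _),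
      integral_add (integrable_const m) hint, hΦ]
    simp
  have h4 : ∫⁻ ω, ENNReal.ofReal (m + g.1 (X ω) - Φ g) ∂P ≤ ENNReal.ofReal r :=
    (lintegral_mono fun ω => hle _).trans hχ
  have h5 := integral_eq_lintegral_pos_part_sub_lintegral_neg_part hint'
  rw [h3] at h5
  have h6 := ENNReal.toReal_le_of_le_ofReal hr h4
  have h7 : 0 ≤ (∫⁻ ω, ENNReal.ofReal (-(m + g.1 (X ω) - Φ g)) ∂P).toReal :=
    ENNReal.toReal_nonneg
  linarith

end RegularityModulus

/-! ### The main equivalence -/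

theorem mainTheorem6 (d : ℕ)
    -- the vector space of bounded continuous functions, with the constants
    (G : Submodule ℝ (MeasClass d → ℝ))
    (hGcont : ∀ g ∈ G, Continuous g)
    (hGbdd : ∀ g ∈ G, ∃ C : ℝ, ∀ A, |g A| ≤ C)
    (hGconst : ∀ c : ℝ, (fun _ : MeasClass d => c) ∈ G)
    -- the regularity modulus and the linear functional
    (χ : MeasClass d → ℝ≥0∞) (hχ : IsRegularityModulus G χ)
    (Φ : G →ₗ[ℝ] ℝ) (hΦone : Φ ⟨fun _ => 1, hGconst 1⟩ = 1)
    -- the commutative group of transformations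
    (Θ : Subgroup (LebTransf d))
    (hΘcomm : ∀ θ ∈ Θ, ∀ θ' ∈ Θ, θ * θ' = θ' * θ)
    (hGstable : ∀ θ ∈ Θ, ∀ g ∈ G, (fun A => g (θ • A)) ∈ G)
    -- approximation of the modulus from below by functions of `G`
    (happrox : ∃ g : ℕ → MeasClass d → ℝ,
      (∀ n, g n ∈ G) ∧ (∀ n A, 0 ≤ g n A ∧ ENNReal.ofReal (g n A) ≤ χ A) ∧
      ∀ A, Tendsto (fun n => ENNReal.ofReal (g n A)) atTop (𝓝 (χ A)))
    -- sub-invariance of the modulus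
    (hχsub : ∀ θ ∈ Θ, ∃ C : ℝ≥0, 0 < C ∧ ∀ A, χ (θ • A) ≤ C * χ A)
    -- invariance of the functional
    (hΦinv : ∀ (θ : LebTransf d) (hθ : θ ∈ Θ) (g : MeasClass d → ℝ) (hg : g ∈ G),
      Φ ⟨fun A => g (θ • A), hGstable θ hθ g hg⟩ = Φ ⟨g, hg⟩)
    (r : ℝ) (hr : 0 ≤ r) :
    (∃ (Ω : Type) (_ : MeasurableSpace Ω) (P : Measure Ω) (X : Ω → MeasClass d),
      IsProbabilityMeasure P ∧ IsInvariantRAMS P Θ X ∧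
      (∀ g : G, ∫ ω, g.1 (X ω) ∂P = Φ g) ∧
      ∫⁻ ω, χ (X ω) ∂P ≤ ENNReal.ofReal r) ↔
    SupInfCondition G χ Φ r := by
  obtain ⟨g, hgG, hgχ, hglim⟩ := happrox
  have hχm : Measurable χ := hχ.lowerSemicontinuous.measurable
  constructor
  · rintro ⟨Ω, _, P, X, hP, ⟨hX, -⟩, hΦ, hχX⟩
    exact supInfCondition_of_represents hGcont hGbdd hX hΦ hr hχX
  · intro h
    -- As `g n ≤ χ`, the number `Φ (g n)` is itself a lower bound of `χ - g n + Φ (g n)`.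
    have hsI : ∀ n, Φ ⟨g n, hgG n⟩ ≤ r := fun n => h.apply_le (g := ⟨g n, hgG n⟩) (m := Φ _)
      fun A hA => by
        have := (ENNReal.ofReal_le_iff_le_toReal hA).1 (hgχ n A).2
        linarith
    have hne := exists_represents hGcont hGbdd hχm (hχ.isCompact_setOf_le hGconst) hr
      fun k m => h.apply_le
    -- This holds for every representing measure, so averaging cannot spoil the bound.
    have hle : ∀ P : ProbabilityMeasure (MeasClass d), Represents Φ (P : Measure (MeasClass d)) →
        ∫⁻ A, χ A ∂(P : Measure (MeasClass d)) ≤ ENNReal.ofReal r := fun P hP =>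
      hP.lintegral_le hGcont hGbdd (g := fun n => ⟨g n, hgG n⟩) (fun n A => (hgχ n A).1) hglim hsI
    have hK : IsCompact {P : ProbabilityMeasure (MeasClass d) |
        Represents Φ (P : Measure (MeasClass d))} :=
      (isCompact_tailSet (hχ.isCompact_setOf_le hGconst) r).of_isClosed_subset
        (isClosed_setOf_represents hGcont hGbdd) fun P hP => mem_tailSet hχm (hle P hP)
    obtain ⟨P, hP, hPinv⟩ := exists_represents_invariant hGcont hGbdd hK hne
      (T := fun (θ : Θ) A => θ.1 • A) (fun θ => MeasClass.continuous_smul θ.1)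
      (fun θ θ' A => by simp only [← mul_smul, hΘcomm _ θ.2 _ θ'.2])
      (fun θ => hGstable _ θ.2) (fun θ k => hΦinv _ θ.2 _ k.2)
    refine ⟨MeasClass d, inferInstance, P, id, inferInstance, ⟨measurable_id, fun θ hθ => ?_⟩,
      hP, hle P hP⟩
    exact ⟨(MeasClass.continuous_smul θ).measurable.aemeasurable, aemeasurable_id, by
      rw [Measure.map_id]
      exact hPinv ⟨θ, hθ⟩⟩
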